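/- Let $W_e$ ($e\in\mathbb N$) be the domain of the $e$-th partial computable function, in the standard enumeration. For equivalence relations $E,F$ on $\mathbb N$, say that $E$ is computably reducible to $F$, written $E\le F$, if there is a computable $f:\mathbb N\to\mathbb N$ such that $n\mathrel{E}n'\iff f(n)\mathrel{F}f(n')$ for all $n,n'\in\mathbb N$; say that $E$ lies properly below $F$ if $E\le F$ and $F\not\le E$. Define equivalence relations on $\mathbb N$ by - $e=^{ce}e'$ if and only if $W_e=W_{e'}$; - $e\mathrel{E}_{\sf min}^{ce}e'$ if and only if $W_e,W_{e'}$ are both nonempty and $\min W_e=\min W_{e'}$, or $W_e=W_{e'}=\emptyset$; - $e\mathrel{E}_{\sf max}^{ce}e'$ if and only if $W_e,W_{e'}$ are both nonempty and finite and $\max W_e=\max W_{e'}$, or $W_e=W_{e'}=\emptyset$, or $W_e,W_{e'}$ are both infinite. A set or relation is called $\Pi^0_2$-complete if it is $\Pi^0_2$ and every $\Pi^0_2$ subset of $\mathbb N$ is many-one reducible to it. **Theorem.** $E_{\sf max}^{ce}$ is not computably reducible to $E_{\sf min}^{ce}$, and $E_{\sf min}^{ce}$ lies properly below $=^{ce}$.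 Moreover, as sets of pairs, $E_{\sf min}^{ce}$ is $\Delta^0_2$ and $E_{\sf max}^{ce}$ is $\Pi^0_2$-complete; indeed $\mathrm{INF}=\{e : W_e\text{ is infinite}\}$ is a $\Pi^0_2$-complete set and is a single equivalence class of $E_{\sf max}^{ce}$. -/

import Mathlib

/-- `W e` is the `e`-th computably enumerable set: the domain of the partial computable function
whose program has Gödel number `e`. -/
def W (e : ℕ) : Set ℕ :=
  {x | ((Denumerable.ofNat Nat.Partrec.Code e).eval x).Dom}

/-- Computable reducibility `E ≤ F` of (equivalence) relations on `ℕ`. -/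
def ComputablyReducible (E F : ℕ → ℕ → Prop) : Prop :=
  ∃ f : ℕ → ℕ, Computable f ∧ ∀ n n' : ℕ, E n n' ↔ F (f n) (f n')

/-- `E` lies properly below `F`: it is reducible to `F`, and `F` is not reducible to `E`. -/
def ProperlyBelow (E F : ℕ → ℕ → Prop) : Prop :=
  ComputablyReducible E F ∧ ¬ ComputablyReducible F E

/-- The relation `E^{ce}` on indices induced by a relation `E` on sets of natural numbers. -/
def onIndices (E : Set ℕ → Set ℕ → Prop) : ℕ → ℕ → Prop :=
  fun e e' => E (W e) (W e')

/-- The relation `=^{ce}`. -/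
def eqCe : ℕ → ℕ → Prop :=
  onIndices (fun A B => A = B)

/-- Both sets have the same least element, or both are empty. -/
def SameMin (A B : Set ℕ) : Prop :=
  (∃ n, IsLeast A n ∧ IsLeast B n) ∨ (A = ∅ ∧ B = ∅)

/-- Both sets have the same greatest element, or both are empty, or both are infinite. -/
def SameMax (A B : Set ℕ) : Prop :=
  (∃ n, IsGreatest A n ∧ IsGreatest B n) ∨ (A = ∅ ∧ B = ∅) ∨ (A.Infinite ∧ B.Infinite)

/-- The relation `E_min^{ce}`. -/
def minCe : ℕ → ℕ → Prop :=
  onIndices SameMin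

/-- The relation `E_max^{ce}`. -/
def maxCe : ℕ → ℕ → Prop :=
  onIndices SameMax

/-- The index set of the infinite computably enumerable sets. -/
def INF (e : ℕ) : Prop :=
  (W e).Infinite

/-- `P` is `Σ⁰₂`: it has the form `∃ m, ∀ n, R a m n` with `R` computable. -/
def IsSigma2 {α : Type} [Primcodable α] (P : α → Prop) : Prop :=
  ∃ R : α × ℕ × ℕ → Prop, ComputablePred R ∧ ∀ a, P a ↔ ∃ m, ∀ n, R (a, m, n)

/-- `P` is `Π⁰₂`: it has the form `∀ m, ∃ n, R a m n` with `R` computable. -/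
def IsPi2 {α : Type} [Primcodable α] (P : α → Prop) : Prop :=
  ∃ R : α × ℕ × ℕ → Prop, ComputablePred R ∧ ∀ a, P a ↔ ∀ m, ∃ n, R (a, m, n)

/-- `P` is `Δ⁰₂`. -/
def IsDelta2 {α : Type} [Primcodable α] (P : α → Prop) : Prop :=
  IsSigma2 P ∧ IsPi2 P

/-- `P` is `Π⁰₂` and every `Π⁰₂` set of natural numbers is many-one reducible to it. -/
def IsPi2Complete {α : Type} [Primcodable α] (P : α → Prop) : Prop :=
  IsPi2 P ∧ ∀ Q : ℕ → Prop, IsPi2 Q → ManyOneReducible Q P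

open Filter Nat.Partrec Nat.Partrec.Code

/-! ### Indices and stages -/

/-! The minimum of `W e` is the limit of a computable function of the stage (`minApprox`), so
`minCe` is limit computable and hence `Δ⁰₂`. `SameMax` amounts to mutual cofinality (`sameMax_iff`),
which is a `∀∃` condition on elements and stages; it is complete because `INF` is, and `INF` is the
class of an index of `ℕ`.

A reduction `f` of `maxCe` to `minCe` would turn `INF` into `{e | minCe b (f e)}` for a fixed `b`.
The recursion theorem refutes this (`not_INF_iff_minCe`): some `W e` consists of the stages at which
the approximations for `b` and `f e` differ, so it is infinite exactly when `minCe b (f e)` fails.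

Upper and lower closures reduce `minCe` and `maxCe` to `eqCe`. Hence `eqCe ≤ minCe` would give
`maxCe ≤ minCe`. -/

theorem W_encode (c : Code) : W (Encodable.encode c) = {x | (c.eval x).Dom} := by
  simp [W]

/-- The s-m-n theorem, for domains. -/
theorem exists_index_dom {f : ℕ → ℕ →. ℕ} (hf : Partrec₂ f) :
    ∃ g : ℕ → ℕ, Computable g ∧ ∀ a x, x ∈ W (g a) ↔ (f a x).Dom := by
  have h : Partrec fun n : ℕ => f n.unpair.1 n.unpair.2 :=
    hf.comp (Computable.fst.comp Computable.unpair) (Computable.snd.comp Computable.unpair)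
  obtain ⟨c, hc⟩ := exists_code.1 (Partrec.nat_iff.1 h)
  refine ⟨fun a => Encodable.encode (c.curry a), ?_, fun a x => ?_⟩
  · exact Computable.encode.comp
      (primrec₂_curry.to_comp.comp (Computable.const c) Computable.id)
  · simp [W_encode, eval_curry, hc]

theorem rfind_some_dom (p : ℕ → Bool) :
    (Nat.rfind fun n => Part.some (p n)).Dom ↔ ∃ n, p n = true :=
  Nat.rfind_dom.trans <| exists_congr fun _ =>
    ⟨fun h => (Part.mem_some_iff.1 h.1).symm,
      fun h => ⟨Part.mem_some_iff.2 h.symm, fun _ => trivial⟩⟩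

/-- The s-m-n theorem, for projections of computable relations. -/
theorem exists_index_of_computable {R : ℕ → ℕ → ℕ → Bool}
    (hR : Computable fun p : (ℕ × ℕ) × ℕ => R p.1.1 p.1.2 p.2) :
    ∃ g : ℕ → ℕ, Computable g ∧ ∀ a x, x ∈ W (g a) ↔ ∃ n, R a x n = true := by
  have h : Partrec₂ fun (a x : ℕ) => Nat.rfind fun n => Part.some (R a x n) :=
    Partrec.rfind (α := ℕ × ℕ) (p := fun q n => Part.some (R q.1 q.2 n)) hR.partrec
  obtain ⟨g, hg, H⟩ := exists_index_dom h
  exact ⟨g, hg, fun a x => (H a x).trans (rfind_some_dom _)⟩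

/-- Rogers' fixed point theorem, for domains. -/
theorem exists_fixed_index {g : ℕ → ℕ} (hg : Computable g) : ∃ e, W (g e) = W e := by
  obtain ⟨c, hc⟩ := fixed_point (f := fun c => Denumerable.ofNat Code (g (Encodable.encode c)))
    ((Computable.ofNat Code).comp (hg.comp Computable.encode))
  exact ⟨Encodable.encode c, by rw [W_encode, ← hc]; rfl⟩

/-- Whether `x` is seen to belong to `W e` within `s` steps. -/
def enters (e s x : ℕ) : Bool :=
  (evaln s (Denumerable.ofNat Code e) x).isSome

theorem primrec_enters : Primrec fun p : (ℕ × ℕ) × ℕ => enters p.1.1 p.1.2 p.2 :=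
  Primrec.option_isSome.comp (primrec_evaln.comp
    (((Primrec.snd.comp Primrec.fst).pair
      ((Primrec.ofNat Code).comp (Primrec.fst.comp Primrec.fst))).pair Primrec.snd))

theorem Primrec.enters {α : Type*} [Primcodable α] {e s x : α → ℕ}
    (he : Primrec e) (hs : Primrec s) (hx : Primrec x) :
    Primrec fun a => enters (e a) (s a) (x a) :=
  primrec_enters.comp ((he.pair hs).pair hx)

theorem mem_W_iff {e x : ℕ} : x ∈ W e ↔ ∃ s, enters e s x = true := by
  simp only [W, Set.mem_ofPred_eq, Part.dom_iff_mem, enters, Option.isSome_iff_exists,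
    evaln_complete]
  exact exists_comm

theorem enters_mono {e s t x : ℕ} (hst : s ≤ t) (h : enters e s x = true) :
    enters e t x = true := by
  obtain ⟨y, hy⟩ := Option.isSome_iff_exists.1 h
  exact Option.isSome_iff_exists.2 ⟨y, evaln_mono hst hy⟩

theorem lt_of_enters {e s x : ℕ} (h : enters e s x = true) : x < s := by
  obtain ⟨y, hy⟩ := Option.isSome_iff_exists.1 h
  exact evaln_bound hy

/-! ### The least element in the limit -/

/-- The least element of `W e` seen within `s` steps, or `s` if there is none. -/
def minApprox (e s : ℕ) : ℕ :=
  (List.range s).findIdx (enters e s)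

theorem primrec_minApprox : Primrec₂ minApprox :=
  Primrec.list_findIdx (Primrec.list_range.comp Primrec.snd)
    (Primrec.enters (Primrec.fst.comp Primrec.fst) (Primrec.snd.comp Primrec.fst) Primrec.snd).to₂

/-- Once `n` has entered, the search stops at `n` for good, since nothing smaller ever enters. -/
theorem minApprox_of_isLeast {e n : ℕ} (h : IsLeast (W e) n) :
    ∀ᶠ s in atTop, minApprox e s = n := by
  obtain ⟨t, ht⟩ := mem_W_iff.1 h.1
  filter_upwards [eventually_ge_atTop t] with s hs
  have hn : n < s := (lt_of_enters ht).trans_le hs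
  rw [minApprox, List.findIdx_eq (by simpa using hn)]
  refine ⟨by simpa using enters_mono hs ht, fun j hj => ?_⟩
  rw [List.getElem_range, ← Bool.not_eq_true]
  exact fun hjs => hj.not_ge (h.2 (mem_W_iff.2 ⟨s, hjs⟩))

theorem minApprox_of_empty {e : ℕ} (h : W e = ∅) (s : ℕ) : minApprox e s = s := by
  have : (List.range s).findIdx (enters e s) = (List.range s).length := by
    rw [List.findIdx_eq_length]
    intro x _
    rw [← Bool.not_eq_true]
    intro hx
    have : x ∈ W e := mem_W_iff.2 ⟨s, hx⟩
    simp [h] at this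
  rwa [List.length_range] at this

theorem isLeast_or_empty (e : ℕ) : (∃ n, IsLeast (W e) n) ∨ W e = ∅ := by
  rcases (W e).eq_empty_or_nonempty with h | h
  · exact Or.inr h
  · exact Or.inl ⟨_, isLeast_csInf h⟩

/-- The default value `s` passes every finite minimum, so an empty set eventually disagrees with a
nonempty one, while two empty sets agree at every stage. -/
theorem minCe_eventually_iff (e e' : ℕ) :
    ∀ᶠ s in atTop, (minCe e e' ↔ minApprox e s = minApprox e' s) := by
  rcases isLeast_or_empty e with ⟨n, hn⟩ | h <;> rcases isLeast_or_empty e' with ⟨n', hn'⟩ | h'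
  · filter_upwards [minApprox_of_isLeast hn, minApprox_of_isLeast hn'] with s hs hs'
    rw [hs, hs']
    constructor
    · rintro (⟨m, hm, hm'⟩ | ⟨h, -⟩)
      · exact (hn.unique hm).trans (hm'.unique hn')
      · exact absurd hn.1 (by simp [h])
    · rintro rfl
      exact Or.inl ⟨n, hn, hn'⟩
  · filter_upwards [minApprox_of_isLeast hn, eventually_gt_atTop n] with s hs hlt
    rw [hs, minApprox_of_empty h']
    refine iff_of_false ?_ hlt.ne
    rintro (⟨m, -, hm'⟩ | ⟨h, -⟩)
    · exact absurd hm'.1 (by simp [h'])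
    · exact absurd hn.1 (by simp [h])
  · filter_upwards [minApprox_of_isLeast hn', eventually_gt_atTop n'] with s hs hlt
    rw [hs, minApprox_of_empty h]
    refine iff_of_false ?_ hlt.ne'
    rintro (⟨m, hm, -⟩ | ⟨-, h'⟩)
    · exact absurd hm.1 (by simp [h])
    · exact absurd hn'.1 (by simp [h'])
  · refine Eventually.of_forall fun s => iff_of_true (Or.inr ⟨h, h'⟩) ?_
    rw [minApprox_of_empty h, minApprox_of_empty h']

theorem isDelta2_minCe : IsDelta2 (fun p : ℕ × ℕ => minCe p.1 p.2) := by
  -- With stage `m + n` one matrix serves both prefixes: a property that stabilises is equally `∃ m,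
  -- ∀ n` and `∀ m, ∃ n`.
  have hR : ComputablePred fun q : (ℕ × ℕ) × ℕ × ℕ =>
      minApprox q.1.1 (q.2.1 + q.2.2) = minApprox q.1.2 (q.2.1 + q.2.2) := by
    have hs : Primrec fun q : (ℕ × ℕ) × ℕ × ℕ => q.2.1 + q.2.2 :=
      Primrec.nat_add.comp (Primrec.fst.comp Primrec.snd) (Primrec.snd.comp Primrec.snd)
    exact (Primrec.eq.comp
      (primrec_minApprox.comp (Primrec.fst.comp Primrec.fst) hs)
      (primrec_minApprox.comp (Primrec.snd.comp Primrec.fst) hs)).computablePred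
  refine ⟨⟨_, hR, fun p => ?_⟩, ⟨_, hR, fun p => ?_⟩⟩ <;>
    obtain ⟨N, hN⟩ := eventually_atTop.1 (minCe_eventually_iff p.1 p.2)
  · exact ⟨fun h => ⟨N, fun n => (hN _ (Nat.le_add_right N n)).1 h⟩,
      fun ⟨m, hm⟩ => (hN (m + N) (Nat.le_add_left N m)).2 (hm N)⟩
  · refine ⟨fun h m => ⟨N, (hN _ (Nat.le_add_left N m)).1 h⟩, fun h => ?_⟩
    obtain ⟨n, hn⟩ := h N
    exact (hN _ (Nat.le_add_right N n)).2 hn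

/-! ### Infinite computably enumerable sets -/

theorem isPi2_INF : IsPi2 INF := by
  -- The witness codes an element together with a stage at which it has entered.
  refine ⟨fun q => q.2.1 ≤ q.2.2.unpair.1 ∧ enters q.1 q.2.2.unpair.2 q.2.2.unpair.1 = true,
    ?_, fun e => ?_⟩
  · have hn : Primrec fun q : ℕ × ℕ × ℕ => q.2.2.unpair :=
      Primrec.unpair.comp (Primrec.snd.comp Primrec.snd)
    exact ((Primrec.nat_le.comp (Primrec.fst.comp Primrec.snd) (Primrec.fst.comp hn)).and
      (Primrec.eq.comp
        (Primrec.enters Primrec.fst (Primrec.snd.comp hn) (Primrec.fst.comp hn))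
        (Primrec.const true))).computablePred
  · rw [INF, Set.infinite_iff_exists_gt]
    constructor
    · intro h m
      obtain ⟨x, hx, hlt⟩ := h m
      obtain ⟨s, hs⟩ := mem_W_iff.1 hx
      exact ⟨Nat.pair x s, by simpa using ⟨hlt.le, hs⟩⟩
    · intro h m
      obtain ⟨n, hle, hn⟩ := h (m + 1)
      exact ⟨_, mem_W_iff.2 ⟨_, hn⟩, hle⟩

/-- On input `x`, search in turn for a witness for each `m < x`. The domain is an initial segment of
`ℕ`, infinite exactly when no search fails. -/
theorem IsPi2.manyOneReducible_INF {Q : ℕ → Prop} (hQ : IsPi2 Q) : ManyOneReducible Q INF := by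
  obtain ⟨R, ⟨_, hR⟩, hQR⟩ := hQ
  let search (a m : ℕ) : Part ℕ := Nat.rfind fun n => Part.some (decide (R (a, m, n)))
  have hsearch : Partrec₂ search :=
    Partrec.rfind (α := ℕ × ℕ) (p := fun q n => Part.some (decide (R (q.1, q.2, n))))
      (hR.comp ((Computable.fst.comp Computable.fst).pair
        ((Computable.snd.comp Computable.fst).pair Computable.snd))).partrec
  have hdom (a m : ℕ) : (search a m).Dom ↔ ∃ n, R (a, m, n) := by
    simpa using rfind_some_dom fun n => decide (R (a, m, n))
  let f (a x : ℕ) : Part ℕ :=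
    x.rec (Part.some 0) fun m IH => IH.bind fun _ => search a m
  have hf : Partrec₂ f :=
    Partrec.nat_rec (f := fun q : ℕ × ℕ => q.2) (g := fun _ => Part.some 0)
      (h := fun q p => search q.1 p.1) Computable.snd (Computable.const 0)
      (hsearch.comp (Computable.fst.comp Computable.fst) (Computable.fst.comp Computable.snd))
  have hfdom (a x : ℕ) : (f a x).Dom ↔ ∀ m < x, ∃ n, R (a, m, n) := by
    induction x with
    | zero => simp [f]
    | succ x ih =>
      have : f a (x + 1) = (f a x).bind fun _ => search a x := rfl
      rw [this, Part.bind_dom, Nat.forall_lt_succ_right, ← ih, ← hdom]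
      exact exists_prop
  obtain ⟨g, hg, H⟩ := exists_index_dom hf
  refine ⟨g, hg, fun a => ?_⟩
  rw [hQR, INF, Set.infinite_iff_exists_gt]
  constructor
  · exact fun h m => ⟨m + 1, (H _ _).2 ((hfdom a (m + 1)).2 fun k _ => h k), m.lt_succ_self⟩
  · intro h m
    obtain ⟨x, hx, hlt⟩ := h m
    exact (hfdom _ _).1 ((H _ _).1 hx) m hlt

theorem isPi2Complete_INF : IsPi2Complete INF :=
  ⟨isPi2_INF, fun _ => IsPi2.manyOneReducible_INF⟩

/-! ### The maximum relation -/

/-- Mutual cofinality avoids deciding which of the three cases holds. If `A` is finite and nonempty,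
its maximum bounds `B` and is dominated by an element of `B`, hence lies in `B`. -/
theorem sameMax_iff {A B : Set ℕ} : SameMax A B ↔
    (∀ x ∈ A, ∃ y ∈ B, x ≤ y) ∧ (∀ x ∈ B, ∃ y ∈ A, x ≤ y) := by
  constructor
  · rintro (⟨n, hA, hB⟩ | ⟨rfl, rfl⟩ | ⟨hA, hB⟩)
    · exact ⟨fun x hx => ⟨n, hB.1, hA.2 hx⟩, fun x hx => ⟨n, hA.1, hB.2 hx⟩⟩
    · simp
    · rw [Set.infinite_iff_exists_gt] at hA hB
      exact ⟨fun x _ => (hB x).imp fun _ h => ⟨h.1, h.2.le⟩,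
        fun x _ => (hA x).imp fun _ h => ⟨h.1, h.2.le⟩⟩
  · rintro ⟨hAB, hBA⟩
    have finite_of {A B : Set ℕ} (hBA : ∀ x ∈ B, ∃ y ∈ A, x ≤ y) (hA : A.Finite) : B.Finite := by
      obtain ⟨n, hn⟩ := hA.bddAbove
      refine Set.Finite.subset (Set.finite_Iic n) fun x hx => ?_
      obtain ⟨y, hy, hxy⟩ := hBA x hx
      exact hxy.trans (hn hy)
    by_cases hA : A.Finite
    · rcases A.eq_empty_or_nonempty with rfl | hne
      · exact Or.inr (Or.inl ⟨rfl, Set.eq_empty_of_forall_notMem fun x hx => by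
          simpa using hBA x hx⟩)
      · obtain ⟨n, hnA⟩ : ∃ n, IsGreatest A n := ⟨_, Nat.sSup_mem hne hA.bddAbove,
          fun x hx => le_csSup hA.bddAbove hx⟩
        have hub : n ∈ upperBounds B := fun x hx => by
          obtain ⟨y, hy, hxy⟩ := hBA x hx
          exact hxy.trans (hnA.2 hy)
        obtain ⟨y, hy, hny⟩ := hAB n hnA.1
        obtain rfl := hny.antisymm (hub hy)
        exact Or.inl ⟨n, hnA, hy, hub⟩
    · exact Or.inr (Or.inr ⟨hA, fun hB => hA (finite_of hAB hB)⟩)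

theorem isPi2_maxCe : IsPi2 (fun p : ℕ × ℕ => maxCe p.1 p.2) := by
  -- Both `m` and `n` code an element with a stage; if `m` codes no actual entry, any `n` will do.
  have key (e e' : ℕ) : (∀ x ∈ W e, ∃ y ∈ W e', x ≤ y) ↔
      ∀ m : ℕ, ∃ n : ℕ, enters e m.unpair.2 m.unpair.1 = true →
        m.unpair.1 ≤ n.unpair.1 ∧ enters e' n.unpair.2 n.unpair.1 = true := by
    constructor
    · intro h m
      by_cases hm : enters e m.unpair.2 m.unpair.1 = true
      · obtain ⟨y, hy, hle⟩ := h _ (mem_W_iff.2 ⟨_, hm⟩)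
        obtain ⟨s, hs⟩ := mem_W_iff.1 hy
        exact ⟨Nat.pair y s, fun _ => by simpa using ⟨hle, hs⟩⟩
      · exact ⟨0, fun h => absurd h hm⟩
    · intro h x hx
      obtain ⟨s, hs⟩ := mem_W_iff.1 hx
      obtain ⟨n, hn⟩ := h (Nat.pair x s)
      simp only [Nat.unpair_pair] at hn
      exact ⟨_, mem_W_iff.2 ⟨_, (hn hs).2⟩, (hn hs).1⟩
  let R (e e' m n : ℕ) : Prop := ¬ enters e m.unpair.2 m.unpair.1 = true ∨
    m.unpair.1 ≤ n.unpair.1 ∧ enters e' n.unpair.2 n.unpair.1 = true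
  have hR {e e' m n : (ℕ × ℕ) × ℕ × ℕ → ℕ} (he : Primrec e) (he' : Primrec e')
      (hm : Primrec m) (hn : Primrec n) :
      PrimrecPred fun q => R (e q) (e' q) (m q) (n q) := by
    have fst {k : (ℕ × ℕ) × ℕ × ℕ → ℕ} (hk : Primrec k) : Primrec fun q => (k q).unpair.1 :=
      Primrec.fst.comp (Primrec.unpair.comp hk)
    have snd {k : (ℕ × ℕ) × ℕ × ℕ → ℕ} (hk : Primrec k) : Primrec fun q => (k q).unpair.2 :=
      Primrec.snd.comp (Primrec.unpair.comp hk)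
    exact (Primrec.eq.comp (Primrec.enters he (snd hm) (fst hm)) (Primrec.const true)).not.or
      ((Primrec.nat_le.comp (fst hm) (fst hn)).and
        (Primrec.eq.comp (Primrec.enters he' (snd hn) (fst hn)) (Primrec.const true)))
  refine ⟨fun q => R q.1.1 q.1.2 q.2.1 q.2.2.unpair.1 ∧ R q.1.2 q.1.1 q.2.1 q.2.2.unpair.2,
    ?_, fun p => ?_⟩
  · have h₁ : Primrec fun q : (ℕ × ℕ) × ℕ × ℕ => q.1.1 := Primrec.fst.comp Primrec.fst
    have h₂ : Primrec fun q : (ℕ × ℕ) × ℕ × ℕ => q.1.2 := Primrec.snd.comp Primrec.fst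
    have h₃ : Primrec fun q : (ℕ × ℕ) × ℕ × ℕ => q.2.1 := Primrec.fst.comp Primrec.snd
    have h₄ : Primrec fun q : (ℕ × ℕ) × ℕ × ℕ => q.2.2.unpair :=
      Primrec.unpair.comp (Primrec.snd.comp Primrec.snd)
    exact ((hR h₁ h₂ h₃ (Primrec.fst.comp h₄)).and
      (hR h₂ h₁ h₃ (Primrec.snd.comp h₄))).computablePred
  · have h := (sameMax_iff (A := W p.1) (B := W p.2)).trans (and_congr (key _ _) (key _ _))
    simp only [imp_iff_not_or] at h
    refine h.trans ?_
    constructor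
    · rintro ⟨h, h'⟩ m
      obtain ⟨n, hn⟩ := h m
      obtain ⟨n', hn'⟩ := h' m
      exact ⟨Nat.pair n n', by simpa [R] using hn, by simpa [R] using hn'⟩
    · exact fun h => ⟨fun m => (h m).elim fun _ hn => ⟨_, hn.1⟩,
        fun m => (h m).elim fun _ hn => ⟨_, hn.2⟩⟩

theorem exists_index_univ : ∃ e, W e = Set.univ := by
  obtain ⟨g, -, hg⟩ := exists_index_of_computable (R := fun _ _ _ => true) (Computable.const true)
  exact ⟨g 0, Set.eq_univ_of_forall fun x => (hg 0 x).2 ⟨0, rfl⟩⟩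

theorem exists_INF_iff_maxCe : ∃ e₀ : ℕ, ∀ e : ℕ, INF e ↔ maxCe e₀ e := by
  obtain ⟨e₀, he₀⟩ := exists_index_univ
  refine ⟨e₀, fun e => ⟨fun h => ?_, ?_⟩⟩
  · exact Or.inr (Or.inr ⟨he₀ ▸ Set.infinite_univ, h⟩)
  · rintro (⟨n, hn, -⟩ | ⟨h, -⟩ | ⟨-, h⟩)
    · exact absurd (hn.2 (he₀ ▸ Set.mem_univ (n + 1))) n.lt_succ_self.not_ge
    · exact absurd (he₀ ▸ h) Set.univ_nonempty.ne_empty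
    · exact h

theorem isPi2Complete_maxCe : IsPi2Complete (fun p : ℕ × ℕ => maxCe p.1 p.2) := by
  refine ⟨isPi2_maxCe, fun Q hQ => hQ.manyOneReducible_INF.trans ?_⟩
  obtain ⟨e₀, he₀⟩ := exists_INF_iff_maxCe
  exact ⟨fun e => (e₀, e), (Computable.const e₀).pair Computable.id, he₀⟩

/-! ### Reductions -/

theorem ComputablyReducible.trans {E F G : ℕ → ℕ → Prop} (h : ComputablyReducible E F)
    (h' : ComputablyReducible F G) : ComputablyReducible E G := by
  obtain ⟨f, hf, H⟩ := h
  obtain ⟨g, hg, H'⟩ := h'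
  exact ⟨g ∘ f, hg.comp hf, fun n n' => (H n n').trans (H' _ _)⟩

/-- If `r` is a decidable relation, the `r`-image of `W e` is computably enumerable,
uniformly in `e`. -/
theorem exists_index_image {r : ℕ → ℕ → Prop} (hr : PrimrecRel r) :
    ∃ g : ℕ → ℕ, Computable g ∧ ∀ e, W (g e) = {x | ∃ y ∈ W e, r y x} := by
  classical
  obtain ⟨g, hg, H⟩ := exists_index_of_computable
    (R := fun e x n => enters e n.unpair.2 n.unpair.1 && decide (r n.unpair.1 x)) <| by
      have hn : Primrec fun p : (ℕ × ℕ) × ℕ => p.2.unpair := Primrec.unpair.comp Primrec.snd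
      exact (Primrec.and.comp
        (Primrec.enters (Primrec.fst.comp Primrec.fst) (Primrec.snd.comp hn) (Primrec.fst.comp hn))
        (hr.decide.comp (Primrec.fst.comp hn) (Primrec.snd.comp Primrec.fst))).to_comp
  refine ⟨g, hg, fun e => Set.ext fun x => ?_⟩
  simp only [H, Bool.and_eq_true, decide_eq_true_eq, Set.mem_ofPred_eq]
  constructor
  · rintro ⟨n, hn, hle⟩
    exact ⟨_, mem_W_iff.2 ⟨_, hn⟩, hle⟩
  · rintro ⟨y, hy, hle⟩
    obtain ⟨s, hs⟩ := mem_W_iff.1 hy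
    exact ⟨Nat.pair y s, by simpa using ⟨hs, hle⟩⟩

/-- The upper closure of a set of naturals is empty or the ray from its minimum, so it carries the
same information as the minimum. -/
theorem sameMin_iff {A B : Set ℕ} : SameMin A B ↔
    {x | ∃ y ∈ A, y ≤ x} = {x | ∃ y ∈ B, y ≤ x} := by
  constructor
  · rintro (⟨n, hA, hB⟩ | ⟨rfl, rfl⟩)
    · ext x
      exact ⟨fun ⟨y, hy, hyx⟩ => ⟨n, hB.1, (hA.2 hy).trans hyx⟩,
        fun ⟨y, hy, hyx⟩ => ⟨n, hA.1, (hB.2 hy).trans hyx⟩⟩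
    · rfl
  · intro h
    rw [Set.ext_iff] at h
    rcases A.eq_empty_or_nonempty with rfl | hne
    · exact Or.inr ⟨rfl, Set.eq_empty_of_forall_notMem fun x hx => by
        simpa using (h x).2 ⟨x, hx, le_rfl⟩⟩
    · have hA := isLeast_csInf hne
      have hlb : sInf A ∈ lowerBounds B := fun x hx => by
        obtain ⟨y, hy, hyx⟩ := (h x).2 ⟨x, hx, le_rfl⟩
        exact (hA.2 hy).trans hyx
      obtain ⟨y, hy, hyA⟩ := (h (sInf A)).1 ⟨_, hA.1, le_rfl⟩
      exact Or.inl ⟨_, hA, hyA.antisymm (hlb hy) ▸ hy, hlb⟩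

theorem sameMax_iff_lowerClosure {A B : Set ℕ} : SameMax A B ↔
    {x | ∃ y ∈ A, y ≥ x} = {x | ∃ y ∈ B, y ≥ x} := by
  rw [sameMax_iff, Set.ext_iff]
  constructor
  · rintro ⟨hAB, hBA⟩ x
    exact ⟨fun ⟨y, hy, hxy⟩ => (hAB y hy).imp fun _ h => ⟨h.1, hxy.trans h.2⟩,
      fun ⟨y, hy, hxy⟩ => (hBA y hy).imp fun _ h => ⟨h.1, hxy.trans h.2⟩⟩
  · exact fun h => ⟨fun x hx => (h x).1 ⟨x, hx, le_rfl⟩, fun x hx => (h x).2 ⟨x, hx, le_rfl⟩⟩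

theorem minCe_reducible_eqCe : ComputablyReducible minCe eqCe := by
  obtain ⟨g, hg, H⟩ := exists_index_image Primrec.nat_le
  exact ⟨g, hg, fun e e' => by simp only [minCe, eqCe, onIndices, H, sameMin_iff]⟩

theorem maxCe_reducible_eqCe : ComputablyReducible maxCe eqCe := by
  obtain ⟨g, hg, H⟩ := exists_index_image (r := fun y x => y ≥ x)
    (Primrec.nat_le.comp Primrec.snd Primrec.fst)
  exact ⟨g, hg, fun e e' => by simp only [maxCe, eqCe, onIndices, H, sameMax_iff_lowerClosure]⟩

/-- Given `f`, the recursion theorem yields an index of a set that grows exactly while the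
approximations to `min (W b)` and `min (W (f e))` differ. -/
theorem not_INF_iff_minCe {f : ℕ → ℕ} (hf : Computable f) (b : ℕ) :
    ¬ ∀ e, INF e ↔ minCe b (f e) := by
  intro h
  obtain ⟨g, hg, H⟩ := exists_index_of_computable
    (R := fun e x _ => !decide (minApprox b x = minApprox (f e) x)) <| by
      have hx : Computable fun p : (ℕ × ℕ) × ℕ => p.1.2 := Computable.snd.comp Computable.fst
      exact Primrec.not.to_comp.comp (Primrec.eq.decide.to_comp.comp
        (primrec_minApprox.to_comp.comp (Computable.const b) hx)
        (primrec_minApprox.to_comp.comp (hf.comp (Computable.fst.comp Computable.fst)) hx))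
  obtain ⟨e, he⟩ := exists_fixed_index hg
  have hmem (x : ℕ) : x ∈ W e ↔ minApprox b x ≠ minApprox (f e) x := by
    rw [← he, H]; simp
  obtain ⟨N, hN⟩ := eventually_atTop.1 (minCe_eventually_iff b (f e))
  -- From stage `N` on the approximations are right: `W e` lies below `N` if `minCe b (f e)` holds
  -- and contains `[N, ∞)` otherwise.
  by_cases hmin : minCe b (f e)
  · refine (h e).2 hmin ((Set.finite_Iio N).subset fun x hx => ?_)
    by_contra hle
    exact (hmem x).1 hx ((hN x (not_lt.1 hle)).1 hmin)
  · refine hmin ((h e).1 ((Set.Ici_infinite N).mono fun x hx => ?_))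
    exact (hmem x).2 fun heq => hmin ((hN x hx).2 heq)

theorem maxCe_not_reducible_minCe : ¬ ComputablyReducible maxCe minCe := by
  rintro ⟨f, hf, H⟩
  obtain ⟨e₀, he₀⟩ := exists_INF_iff_maxCe
  exact not_INF_iff_minCe hf (f e₀) fun e => (he₀ e).trans (H e₀ e)

theorem mainTheorem7 :
    ¬ ComputablyReducible maxCe minCe ∧
    ProperlyBelow minCe eqCe ∧
    IsDelta2 (fun p : ℕ × ℕ => minCe p.1 p.2) ∧
    IsPi2Complete (fun p : ℕ × ℕ => maxCe p.1 p.2) ∧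
    IsPi2Complete INF ∧
    (∃ e₀ : ℕ, ∀ e : ℕ, INF e ↔ maxCe e₀ e) :=
  ⟨maxCe_not_reducible_minCe,
    ⟨minCe_reducible_eqCe, fun h => maxCe_not_reducible_minCe (maxCe_reducible_eqCe.trans h)⟩,
    isDelta2_minCe, isPi2Complete_maxCe, isPi2Complete_INF, exists_INF_iff_maxCe⟩
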